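/- **Ultragraphs.** An ultragraph $\mathcal U=(U^0,\mathcal U^1,r,s)$ consists of a set $U^0$ of vertices, a set $\mathcal U^1$ of edges and maps $r,s:\mathcal U^1\to P(U^0)\setminus\{\emptyset\}$ such that every $r(e)$ is a singleton. It is row-finite without sources if $\{e\in\mathcal U^1: r(e)=\{v\}\}$ is finite and nonempty for every $v\in U^0$. Let $\mathcal U^0$ be the smallest family of subsets of $U^0$ that contains $\emptyset$, all $\{v\}$ and all $s(e)$ and is closed under $\cap,\cup,\setminus$. A path of length $n\ge1$ is a sequence $\alpha=e_1\cdots e_n$ of edges with $r(e_{i+1})\subseteq s(e_i)$; put $r(\alpha)=r(e_1)$ and $s(\alpha)=s(e_n)$. Let $\mathcal U^{\ge1}$ be the set of these paths and $\mathcal U^\sharp=\mathcal U^{\ge1}\cup\{\omega\}$, where $\omega$ is a path of length zero with $\omega\alpha=\alpha\omega=\alpha$ and $r(\omega)=s(\omega)=U^0$. **Self-similar ultragraphs.** A self-similar ultragraph $(G,\mathcal U,\varphi)$ is a row-finite ultragraph $\mathcal U$ without sources, a discrete group $G$ acting on $U^0$ and on $\mathcal U^1$ with $r(g\cdot e)=g\cdot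 r(e)$ and $s(g\cdot e)=g\cdot s(e)$, and a map $\varphi:G\times\mathcal U^1\to G$ with $\varphi(gh,e)=\varphi(g,h\cdot e)\,\varphi(h,e)$ and $\varphi(g,e)\cdot s(e)\subseteq g\cdot s(e)$. Action and cocycle are extended to $\mathcal U^\sharp$ by $g\cdot\omega=\omega$, $\varphi(g,\omega)=g$, $g\cdot(e\alpha)=(g\cdot e)(\varphi(g,e)\cdot\alpha)$ and $\varphi(g,e\alpha)=\varphi(\varphi(g,e),\alpha)$. **The inverse semigroup.** $\mathcal S_{G,\mathcal U}$ consists of a zero element $0$ and all $(\alpha,A,g,\beta)$ with $\alpha,\beta\in\mathcal U^\sharp$, $g\in G$, $A\in\mathcal U^0$ and $\emptyset\ne A\subseteq s(\alpha)\cap g\cdot s(\beta)$. Its involution is $(\alpha,A,g,\beta)^*=(\beta,g^{-1}\cdot A,g^{-1},\alpha)$, $0^*=0$, and the product $(\alpha,A,g,\beta)(\gamma,B,h,\delta)$ is * $\big(\alpha(g\cdot\varepsilon),\ s(g\cdot\varepsilon)\cap(\varphi(g,\varepsilon)\cdot B),\ \varphi(g,\varepsilon)h,\ \delta\big)$ if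 $\gamma=\beta\varepsilon$ with $\varepsilon\in\mathcal U^{\ge1}$ and $g\cdot r(\varepsilon)\subseteq A$; * $\big(\alpha,\ A\cap(k\cdot s(h^{-1}\cdot\varepsilon)),\ k,\ \delta(h^{-1}\cdot\varepsilon)\big)$ with $k=g\,\varphi(h^{-1},\varepsilon)^{-1}$ if $\beta=\gamma\varepsilon$ with $\varepsilon\in\mathcal U^{\ge1}$ and $r(\varepsilon)\subseteq B$; * $(\alpha,\ A\cap(g\cdot B),\ gh,\ \delta)$ if $\gamma=\beta$ and $A\cap(g\cdot B)\neq\emptyset$; * $0$ otherwise (and whenever a factor is $0$). **The tight groupoid.** Let $S$ be an inverse semigroup with $0$, let $\mathcal E(S)$ be its set of idempotents, and write $s\le t$ if $s=te$ for some $e\in\mathcal E(S)$. A filter is a nonempty subset of $\mathcal E(S)$ that is closed under products and upward closed in $\mathcal E(S)$. The filters not containing $0$ form a space $\widehat{\mathcal E}_0(S)$, with the topology generated by the sets $\{\mathcal F: e\in\mathcal F,\ e_1,\dots,e_n\notin\mathcal F\}$ for $e,e_1,\dots,e_n\in\mathcal E(S)$, $n\ge 0$; ultrafilters are its maximal elements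 under inclusion. The tight spectrum $\widehat{\mathcal E}_{\rm tight}(S)$ is the closure of the set of ultrafilters in $\widehat{\mathcal E}_0(S)$. The tight groupoid $\mathcal G_{\rm tight}(S)$ is the set of germs $[s,\mathcal F]$ with $s\in S$, $\mathcal F\in\widehat{\mathcal E}_{\rm tight}(S)$ and $s^*s\in\mathcal F$, where $[s,\mathcal F]=[t,\mathcal F']$ iff $\mathcal F=\mathcal F'$ and $se=te$ for some $e\in\mathcal F$; its topology is generated by the sets $[s,W]=\{[s,\mathcal F]:\mathcal F\in W,\ s^*s\in\mathcal F\}$ with $s\in S$ and $W\subseteq\widehat{\mathcal E}_{\rm tight}(S)$ open. **Strongly fixed paths.** For $g\in G$ let $\mathbf{SF}_g$ be the set of $\alpha\in\mathcal U^{\ge1}$ with $g\cdot\alpha=\alpha$ and $\varphi(g,\alpha)=1_G$, and for $A\in\mathcal U^0$ let $A\mathbf{SF}_g=\{\gamma\in\mathbf{SF}_g:r(\gamma)\subseteq A\}$. An element of $A\mathbf{SF}_g$ is minimal if no other element of $A\mathbf{SF}_g$ is an initial subpath of it. **Theorem.** Let $(G,\mathcal U,\varphi)$ be a self-similar ultragraph.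 If for every $g\in G\setminus\{1_G\}$, all $v\in U^0$ and all $e\in\mathcal U^1$ the sets $\{v\}\mathbf{SF}_g$ and $s(e)\mathbf{SF}_g$ have only finitely many minimal elements, then $\mathcal G_{\rm tight}(\mathcal S_{G,\mathcal U})$ is Hausdorff. Conversely, if $\mathcal G_{\rm tight}(\mathcal S_{G,\mathcal U})$ is Hausdorff, then all these sets have only finitely many minimal elements. -/

import Mathlib

/-! ## Inverse semigroups with zero, tight filters, and the tight groupoid of germs -/

/-- An inverse semigroup with zero: every `s` has a unique generalized inverse `star s`. -/
class InverseSemigroupWithZero (S : Type*) extends SemigroupWithZero S, Star S where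
  mul_star_mul : ∀ s : S, s * star s * s = s
  star_mul_star : ∀ s : S, star s * s * star s = star s
  star_unique : ∀ s t : S, s * t * s = s → t * s * t = t → t = star s

namespace InverseSemigroupWithZero

variable {S : Type*} [InverseSemigroupWithZero S]

lemma star_eq_self {e : S} (he : IsIdempotentElem e) : star e = e :=
  (star_unique e e (by rw [he.eq, he.eq]) (by rw [he.eq, he.eq])).symm

lemma isIdempotentElem_mul {e f : S} (he : IsIdempotentElem e) (hf : IsIdempotentElem f) :
    IsIdempotentElem (e * f) := by
  have h1 := mul_star_mul (e * f)
  have h2 := star_mul_star (e * f)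
  set x := star (e * f)
  have he' : ∀ y : S, e * (e * y) = e * y := fun y => by rw [← mul_assoc, he.eq]
  have hf' : ∀ y : S, f * (f * y) = f * y := fun y => by rw [← mul_assoc, hf.eq]
  simp only [mul_assoc] at h1 h2
  have h2' : ∀ y : S, x * (e * (f * (x * y))) = x * y := fun y => by
    have := congrArg (· * y) h2
    simpa only [mul_assoc] using this
  have hfx : f * x * e = x := by
    refine star_unique (e * f) (f * x * e) ?_ ?_
    · simp only [mul_assoc, he', hf', h1]
    · simp only [mul_assoc, he', hf', h2']
  have hxi : IsIdempotentElem x := by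
    have : f * x * e * (f * x * e) = f * x * e := by
      simp only [mul_assoc, h2']
    rwa [hfx] at this
  have : e * f = star x := star_unique x (e * f) (by simpa only [mul_assoc] using h2)
    (by simpa only [mul_assoc] using h1)
  rw [star_eq_self hxi] at this
  rw [this]
  exact hxi

/-- Idempotents of an inverse semigroup commute. -/
lemma idem_comm {e f : S} (he : IsIdempotentElem e) (hf : IsIdempotentElem f) :
    e * f = f * e := by
  have he' : ∀ y : S, e * (e * y) = e * y := fun y => by rw [← mul_assoc, he.eq]
  have hf' : ∀ y : S, f * (f * y) = f * y := fun y => by rw [← mul_assoc, hf.eq]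
  have h1 := (isIdempotentElem_mul he hf).eq
  have h2 := (isIdempotentElem_mul hf he).eq
  simp only [mul_assoc] at h1 h2
  have : f * e = star (e * f) := by
    apply star_unique
    · simp only [mul_assoc, he', hf', h1]
    · simp only [mul_assoc, he', hf', h2]
  rw [this, star_eq_self (isIdempotentElem_mul he hf)]

/-- The natural partial order: `s ≤ t` iff `s = t e` for some idempotent `e`. -/
def NatLE (s t : S) : Prop := ∃ e : S, IsIdempotentElem e ∧ s = t * e

/-- Filters in the semilattice of idempotents: nonempty sets of idempotents, closed under
products and upward closed among the idempotents. -/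
structure IsFilter (F : Set S) : Prop where
  nonempty : F.Nonempty
  idem : ∀ e ∈ F, IsIdempotentElem e
  mul_mem : ∀ e ∈ F, ∀ f ∈ F, e * f ∈ F
  up_mem : ∀ e ∈ F, ∀ f : S, IsIdempotentElem f → NatLE e f → f ∈ F

variable (S) in
/-- The space of all filters without `0`. -/
def FilterSpace : Type _ := {F : Set S // IsFilter F ∧ (0 : S) ∉ F}

/-- The set `N(e; e₁, …, eₙ)`, with `T = {e₁, …, eₙ}`, of filters containing `e` and none of the
`eᵢ`. -/
def basicNhd (e : S) (T : Finset S) : Set (FilterSpace S) :=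
  {F | e ∈ F.1 ∧ ∀ f ∈ T, f ∉ F.1}

/-- The topology generated by the sets `N(e; e₁, …, eₙ)`, for idempotents `e, e₁, …, eₙ`. -/
instance : TopologicalSpace (FilterSpace S) :=
  TopologicalSpace.generateFrom
    {N | ∃ (e : S) (T : Finset S), IsIdempotentElem e ∧ (∀ f ∈ T, IsIdempotentElem f) ∧
      N = basicNhd e T}

variable (S) in
/-- The ultrafilters: maximal elements among the filters without `0`. (A filter is proper iff it
does not contain `0`.) -/
def ultrafilters : Set (FilterSpace S) :=
  {F | ∀ F' : FilterSpace S, F.1 ⊆ F'.1 → F'.1 = F.1}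

variable (S) in
/-- The tight spectrum: the closure of the ultrafilters, with the subspace topology. -/
def TightSpectrum : Type _ := {F : FilterSpace S // F ∈ closure (ultrafilters S)}

instance : TopologicalSpace (TightSpectrum S) :=
  inferInstanceAs (TopologicalSpace {F : FilterSpace S // F ∈ closure (ultrafilters S)})

/-- The underlying set of idempotents of a tight filter. -/
def TightSpectrum.carrier (F : TightSpectrum S) : Set S := F.1.1

variable (S) in
/-- The pairs `(s, F)` with `F` a tight filter containing `s* s`. -/
structure GermPair where
  elt : S
  filter : TightSpectrum S
  mem : star elt * elt ∈ filter.carrier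

variable (S) in
/-- `(s, F) ∼ (t, F')` iff `F = F'` and `s e = t e` for some `e ∈ F`. -/
instance germSetoid : Setoid (GermPair S) where
  r p q := p.filter = q.filter ∧ ∃ e ∈ p.filter.carrier, p.elt * e = q.elt * e
  iseqv :=
    { refl := fun p => ⟨rfl, _, p.mem, rfl⟩
      symm := fun {p q} ⟨h, e, he, h'⟩ => ⟨h.symm, e, h ▸ he, h'.symm⟩
      trans := fun {p q r} ⟨h, e, he, h'⟩ ⟨k, f, hf, k'⟩ => by
        rw [← h] at hf
        have hF : IsFilter p.filter.carrier := p.filter.1.2.1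
        refine ⟨h.trans k, e * f, hF.mul_mem _ he _ hf, ?_⟩
        rw [← mul_assoc, h', mul_assoc, idem_comm (hF.idem _ he) (hF.idem _ hf), ← mul_assoc, k',
          mul_assoc] }

variable (S) in
/-- The tight groupoid of germs (as a space; its algebraic operations are not needed to speak of
its topology). Its elements are the germs `[s, F]`. -/
def TightGroupoid : Type _ := Quotient (germSetoid S)

/-- The set `[s, W]` of the germs `[s, F]` with `F ∈ W`. -/
def germSet (s : S) (W : Set (TightSpectrum S)) : Set (TightGroupoid S) :=
  {x | ∃ p : GermPair S, p.elt = s ∧ p.filter ∈ W ∧ x = Quotient.mk (germSetoid S) p}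

/-- The topology generated by the sets `[s, W]` with `s ∈ S` and `W` open in the tight spectrum. -/
instance : TopologicalSpace (TightGroupoid S) :=
  TopologicalSpace.generateFrom
    {O | ∃ (s : S) (W : Set (TightSpectrum S)), IsOpen W ∧ O = germSet s W}

end InverseSemigroupWithZero

/-! ## Self-similar ultragraphs -/

/-- An ultragraph with vertex set `V` and edge set `E`: each edge has a range, which is a single
vertex `rng e` (so `r(e) = {rng e}`), and a source, which is a nonempty set of vertices. -/
structure Ultragraph (V E : Type*) where
  rng : E → V
  src : E → Set V
  src_nonempty : ∀ e, (src e).Nonempty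

namespace Ultragraph

variable {V E : Type*} (U : Ultragraph V E)

/-- Every vertex receives finitely many edges. -/
def RowFinite : Prop := ∀ v, {e | U.rng e = v}.Finite

/-- Every vertex receives at least one edge. -/
def NoSources : Prop := ∀ v, {e | U.rng e = v}.Nonempty

/-- `U.Gen A` says that `A` belongs to the smallest family of vertex sets that contains `∅`, the
singletons and the sets `s(e)`, and is closed under `∩`, `∪` and set difference. -/
inductive Gen : Set V → Prop
  | empty : Gen ∅
  | singleton (v : V) : Gen {v}
  | source (e : E) : Gen (U.src e)
  | inter {A B : Set V} : Gen A → Gen B → Gen (A ∩ B)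
  | union {A B : Set V} : Gen A → Gen B → Gen (A ∪ B)
  | diff {A B : Set V} : Gen A → Gen B → Gen (A \ B)

/-- A list of edges `e₁ … eₙ` with `r(eᵢ₊₁) ⊆ s(eᵢ)`. The empty list is the universal zero-length
path `ω`, and concatenation of lists is juxtaposition of paths. -/
def IsPath (l : List E) : Prop := l.IsChain (fun e f => U.rng f ∈ U.src e)

/-- The range of a path, `r(e₁ … eₙ) = r(e₁)`, with `r(ω)` the set of all vertices. -/
def pathRng : List E → Set V
  | [] => Set.univ
  | e :: _ => {U.rng e}

/-- The source of a path, `s(e₁ … eₙ) = s(eₙ)`, with `s(ω)` the set of all vertices. -/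
def pathSrc (l : List E) : Set V :=
  match l.getLast? with
  | none => Set.univ
  | some e => U.src e

lemma pathSrc_concat (l : List E) (e : E) : U.pathSrc (l ++ [e]) = U.src e := by
  simp [pathSrc]

lemma pathSrc_append (l : List E) {m : List E} (hm : m ≠ []) :
    U.pathSrc (l ++ m) = U.pathSrc m := by
  obtain rfl | ⟨m', e, rfl⟩ := m.eq_nil_or_concat
  · exact absurd rfl hm
  · rw [List.concat_eq_append, ← List.append_assoc, pathSrc_concat, pathSrc_concat]

lemma gen_pathSrc {l : List E} (hl : l ≠ []) : U.Gen (U.pathSrc l) := by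
  obtain rfl | ⟨m', e, rfl⟩ := l.eq_nil_or_concat
  · exact absurd rfl hl
  · rw [List.concat_eq_append, pathSrc_concat]
    exact Gen.source e

lemma IsPath.append {l m : List E} (hl : U.IsPath l) (hm : U.IsPath m)
    (h : U.pathRng m ⊆ U.pathSrc l) : U.IsPath (l ++ m) := by
  refine List.IsChain.append hl hm ?_
  intro x hx y hy
  cases m with
  | nil => simp at hy
  | cons e m =>
    simp only [List.head?_cons, Option.mem_def, Option.some.injEq] at hy
    subst hy
    have : U.pathSrc l = U.src x := by
      unfold pathSrc
      rw [Option.mem_def.1 hx]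
    rw [this] at h
    exact h rfl

end Ultragraph

open scoped Pointwise in
/-- A self-similar ultragraph: a group `G` acting by automorphisms on a row-finite ultragraph
without sources, and a 1-cocycle `φ : G × E → G` with `φ(g, e) · s(e) ⊆ g · s(e)`. -/
structure SelfSimilarUltragraph (G V E : Type*) [Group G] [MulAction G V] [MulAction G E]
    extends Ultragraph V E where
  rowFinite : toUltragraph.RowFinite
  noSources : toUltragraph.NoSources
  rng_smul : ∀ (g : G) (e : E), rng (g • e) = g • rng e
  src_smul : ∀ (g : G) (e : E), src (g • e) = g • src e
  φ : G → E → G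
  φ_mul : ∀ (g h : G) (e : E), φ (g * h) e = φ g (h • e) * φ h e
  φ_smul_src : ∀ (g : G) (e : E), φ g e • src e ⊆ g • src e

namespace SelfSimilarUltragraph

open scoped Pointwise

variable {G V E : Type*} [Group G] [MulAction G V] [MulAction G E]
  (U : SelfSimilarUltragraph G V E)

/-- The extended action on paths: `g · (e α) = (g · e) (φ(g, e) · α)` and `g · ω = ω`. -/
def act : G → List E → List E
  | _, [] => []
  | g, e :: l => (g • e) :: act (U.φ g e) l

/-- The extended cocycle on paths: `φ(g, e α) = φ(φ(g, e), α)` and `φ(g, ω) = g`. -/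
def coc : G → List E → G
  | g, [] => g
  | g, e :: l => coc (U.φ g e) l

/-- The set of paths of positive length that are strongly fixed by `g`. -/
def SF (g : G) : Set (List E) :=
  {α | α ≠ [] ∧ U.IsPath α ∧ U.act g α = α ∧ U.coc g α = 1}

/-- The strongly fixed paths by `g` with range contained in `A`. -/
def SFIn (A : Set V) (g : G) : Set (List E) := {γ | γ ∈ U.SF g ∧ U.pathRng γ ⊆ A}

/-- The minimal elements of a set of paths: those with no other member of the set as an initial
subpath. -/
def minimalPaths (X : Set (List E)) : Set (List E) :=
  {γ | γ ∈ X ∧ ∀ τ ∈ X, τ <+: γ → τ = γ}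

/-! ### Properties of the extended action and cocycle -/

lemma φ_one (e : E) : U.φ 1 e = 1 := by
  have := U.φ_mul 1 1 e
  simpa using this

lemma φ_smul_src_eq (g : G) (e : E) : U.φ g e • U.src e = g • U.src e := by
  refine (U.φ_smul_src g e).antisymm ?_
  have h := U.φ_smul_src g⁻¹ (g • e)
  have h1 : U.φ g⁻¹ (g • e) = (U.φ g e)⁻¹ := by
    have := U.φ_mul g⁻¹ g e
    rw [inv_mul_cancel, φ_one] at this
    exact eq_inv_of_mul_eq_one_left this.symm
  rw [h1, U.src_smul, inv_smul_smul] at h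
  exact Set.subset_smul_set_iff.2 h

@[simp] lemma act_nil (g : G) : U.act g [] = [] := rfl

@[simp] lemma coc_nil (g : G) : U.coc g [] = g := rfl

@[simp] lemma act_cons (g : G) (e : E) (l : List E) :
    U.act g (e :: l) = (g • e) :: U.act (U.φ g e) l := rfl

@[simp] lemma coc_cons (g : G) (e : E) (l : List E) :
    U.coc g (e :: l) = U.coc (U.φ g e) l := rfl

lemma act_one (l : List E) : U.act 1 l = l := by
  induction l with
  | nil => rfl
  | cons e l ih => simp [φ_one, ih]

lemma coc_one (l : List E) : U.coc 1 l = 1 := by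
  induction l with
  | nil => rfl
  | cons e l ih => simp [φ_one, ih]

lemma act_append (g : G) (l m : List E) :
    U.act g (l ++ m) = U.act g l ++ U.act (U.coc g l) m := by
  induction l generalizing g with
  | nil => rfl
  | cons e l ih => simp [ih]

lemma coc_append (g : G) (l m : List E) :
    U.coc g (l ++ m) = U.coc (U.coc g l) m := by
  induction l generalizing g with
  | nil => rfl
  | cons e l ih => simp [ih]

lemma act_mul (g h : G) (l : List E) : U.act (g * h) l = U.act g (U.act h l) := by
  induction l generalizing g h with
  | nil => rfl
  | cons e l ih => simp [mul_smul, U.φ_mul, ih]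

lemma coc_mul (g h : G) (l : List E) :
    U.coc (g * h) l = U.coc g (U.act h l) * U.coc h l := by
  induction l generalizing g h with
  | nil => rfl
  | cons e l ih => simp [U.φ_mul, ih]

lemma act_ne_nil {g : G} {l : List E} (hl : l ≠ []) : U.act g l ≠ [] := by
  cases l with
  | nil => exact absurd rfl hl
  | cons e l => simp

lemma coc_inv_act (g : G) (l : List E) : U.coc g⁻¹ (U.act g l) = (U.coc g l)⁻¹ := by
  have := U.coc_mul g⁻¹ g l
  rw [inv_mul_cancel, coc_one] at this
  exact eq_inv_of_mul_eq_one_left this.symm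

lemma coc_act_inv (g : G) (l : List E) : U.coc g (U.act g⁻¹ l) = (U.coc g⁻¹ l)⁻¹ := by
  simpa using U.coc_inv_act g⁻¹ l

lemma act_inv_act (g : G) (l : List E) : U.act g⁻¹ (U.act g l) = l := by
  rw [← act_mul, inv_mul_cancel, act_one]

lemma act_act_inv (g : G) (l : List E) : U.act g (U.act g⁻¹ l) = l := by
  rw [← act_mul, mul_inv_cancel, act_one]

lemma isPath_act {g : G} {l : List E} (hl : U.IsPath l) : U.IsPath (U.act g l) := by
  induction l generalizing g with
  | nil => exact List.isChain_nil
  | cons e l ih =>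
    cases l with
    | nil => exact List.isChain_singleton _
    | cons f l =>
      have h := List.isChain_cons_cons.1 hl
      refine List.isChain_cons_cons.2 ⟨?_, ih (g := U.φ g e) h.2⟩
      rw [U.rng_smul, U.src_smul, ← U.φ_smul_src_eq]
      exact Set.smul_mem_smul_set h.1

lemma pathRng_act (g : G) (l : List E) : U.pathRng (U.act g l) = g • U.pathRng l := by
  cases l with
  | nil => simp [Ultragraph.pathRng]
  | cons e l => simp [Ultragraph.pathRng, U.rng_smul]

lemma pathSrc_act (g : G) (l : List E) :
    U.pathSrc (U.act g l) = U.coc g l • U.pathSrc l := by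
  obtain rfl | ⟨m, e, rfl⟩ := l.eq_nil_or_concat
  · simp [Ultragraph.pathSrc]
  · rw [List.concat_eq_append, act_append, coc_append, act_cons, act_nil, coc_cons, coc_nil,
      Ultragraph.pathSrc_concat, Ultragraph.pathSrc_concat, U.src_smul, U.φ_smul_src_eq]

lemma gen_smul (g : G) {A : Set V} (hA : U.Gen A) : U.Gen (g • A) := by
  induction hA with
  | empty => simpa using Ultragraph.Gen.empty
  | singleton v => simpa using Ultragraph.Gen.singleton (g • v)
  | source e => rw [← U.src_smul]; exact Ultragraph.Gen.source _
  | inter _ _ h1 h2 => rw [Set.smul_set_inter]; exact h1.inter h2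
  | union _ _ h1 h2 => rw [Set.smul_set_union]; exact h1.union h2
  | diff _ _ h1 h2 => rw [Set.smul_set_sdiff]; exact h1.diff h2

/-! ### The inverse semigroup -/

/-- The condition on `(α, A, g, β)` to be a nonzero element of the inverse semigroup: `α` and `β`
are paths of positive length or `ω`, and `A` is a generalized vertex with
`∅ ≠ A ⊆ s(α) ∩ g · s(β)`. -/
structure Valid (α : List E) (A : Set V) (g : G) (β : List E) : Prop where
  path_left : U.IsPath α
  path_right : U.IsPath β
  gen : U.Gen A
  nonempty : A.Nonempty
  subset : A ⊆ U.pathSrc α ∩ g • U.pathSrc β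

/-- The inverse semigroup of a self-similar ultragraph: the quadruples `(α, A, g, β)` as in
`Valid`, together with a zero. -/
inductive Semi
  | zero : Semi
  | elt (α : List E) (A : Set V) (g : G) (β : List E) (h : U.Valid α A g β) : Semi

variable {U}

lemma Valid.ext_right {α β γ δ ε : List E} {A B : Set V} {g h : G}
    (s : U.Valid α A g β) (t : U.Valid γ B h δ)
    (hc : γ = β ++ ε ∧ ε ≠ [] ∧ g • U.pathRng ε ⊆ A) :
    U.Valid (α ++ U.act g ε) (U.pathSrc (U.act g ε) ∩ U.coc g ε • B) (U.coc g ε * h) δ := by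
  obtain ⟨rfl, hε, hr⟩ := hc
  have hB : B ⊆ U.pathSrc ε := by
    have := t.subset.trans Set.inter_subset_left
    rwa [Ultragraph.pathSrc_append _ _ hε] at this
  have hB' : U.coc g ε • B ⊆ U.pathSrc (U.act g ε) := by
    rw [pathSrc_act]
    exact Set.smul_set_mono hB
  refine ⟨?_, t.path_right, ?_, ?_, ?_⟩
  · refine Ultragraph.IsPath.append _ s.path_left
      (U.isPath_act (List.IsChain.right_of_append t.path_left)) ?_
    rw [pathRng_act]
    exact hr.trans (s.subset.trans Set.inter_subset_left)
  · exact (U.gen_pathSrc (U.act_ne_nil hε)).inter (U.gen_smul _ t.gen)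
  · rw [Set.inter_eq_right.2 hB']
    exact t.nonempty.smul_set
  · rw [Ultragraph.pathSrc_append _ _ (U.act_ne_nil hε), mul_smul]
    exact Set.inter_subset_inter_right _
      (Set.smul_set_mono (t.subset.trans Set.inter_subset_right))

lemma Valid.subset_ext {α β γ ε : List E} {A : Set V} {g : G} (h : G)
    (s : U.Valid α A g β) (hc : β = γ ++ ε ∧ ε ≠ []) :
    A ⊆ (g * (U.coc h⁻¹ ε)⁻¹) • U.pathSrc (U.act h⁻¹ ε) := by
  obtain ⟨rfl, hε⟩ := hc
  have := s.subset.trans Set.inter_subset_right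
  rw [Ultragraph.pathSrc_append _ _ hε] at this
  rwa [pathSrc_act, mul_smul, inv_smul_smul]

lemma Valid.ext_left {α β γ δ ε : List E} {A B : Set V} {g h : G}
    (s : U.Valid α A g β) (t : U.Valid γ B h δ)
    (hc : β = γ ++ ε ∧ ε ≠ [] ∧ U.pathRng ε ⊆ B) :
    U.Valid α (A ∩ (g * (U.coc h⁻¹ ε)⁻¹) • U.pathSrc (U.act h⁻¹ ε))
      (g * (U.coc h⁻¹ ε)⁻¹) (δ ++ U.act h⁻¹ ε) := by
  have hA := s.subset_ext h ⟨hc.1, hc.2.1⟩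
  obtain ⟨rfl, hε, hr⟩ := hc
  refine ⟨s.path_left, ?_, ?_, ?_, ?_⟩
  · refine Ultragraph.IsPath.append _ t.path_right
      (U.isPath_act (List.IsChain.right_of_append s.path_right)) ?_
    rw [pathRng_act, ← Set.subset_smul_set_iff]
    exact hr.trans (t.subset.trans Set.inter_subset_right)
  · exact s.gen.inter (U.gen_smul _ (U.gen_pathSrc (U.act_ne_nil hε)))
  · rw [Set.inter_eq_left.2 hA]
    exact s.nonempty
  · rw [Ultragraph.pathSrc_append _ _ (U.act_ne_nil hε)]
    exact Set.inter_subset_inter_left _ (s.subset.trans Set.inter_subset_left)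

lemma Valid.ext_same {α β γ δ : List E} {A B : Set V} {g h : G}
    (s : U.Valid α A g β) (t : U.Valid γ B h δ) (hc : γ = β ∧ (A ∩ g • B).Nonempty) :
    U.Valid α (A ∩ g • B) (g * h) δ := by
  refine ⟨s.path_left, t.path_right, s.gen.inter (U.gen_smul _ t.gen), hc.2, ?_⟩
  rw [mul_smul]
  exact Set.inter_subset_inter (s.subset.trans Set.inter_subset_left)
    (Set.smul_set_mono (t.subset.trans Set.inter_subset_right))

lemma Valid.star {α β : List E} {A : Set V} {g : G} (s : U.Valid α A g β) :
    U.Valid β (g⁻¹ • A) g⁻¹ α := by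
  refine ⟨s.path_right, s.path_left, U.gen_smul _ s.gen, s.nonempty.smul_set, ?_⟩
  refine Set.subset_inter ?_ (Set.smul_set_mono (s.subset.trans Set.inter_subset_left))
  rw [← Set.subset_smul_set_iff]
  exact s.subset.trans Set.inter_subset_right

namespace Semi

instance : Zero (Semi U) := ⟨Semi.zero⟩

open Classical in
/-- The product of `(α, A, g, β)` and `(γ, B, h, δ)` is
* `(α (g · ε), s(g · ε) ∩ φ(g, ε) · B, φ(g, ε) h, δ)` if `γ = β ε` with `ε ≠ ω` and
  `g · r(ε) ⊆ A`;
* `(α, A ∩ k · s(h⁻¹ · ε), k, δ (h⁻¹ · ε))` with `k = g φ(h⁻¹, ε)⁻¹` if `β = γ ε` with `ε ≠ ω`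
  and `r(ε) ⊆ B`;
* `(α, A ∩ g · B, g h, δ)` if `γ = β` and `A ∩ g · B ≠ ∅`;
* zero otherwise.

In the first two cases `ε` is what remains of the longer path when the shorter one is dropped. -/
noncomputable def mul : Semi U → Semi U → Semi U
  | zero, _ => zero
  | elt _ _ _ _ _, zero => zero
  | elt α A g β s, elt γ B h δ t =>
    if h1 : γ = β ++ γ.drop β.length ∧ γ.drop β.length ≠ [] ∧
        g • U.pathRng (γ.drop β.length) ⊆ A then
      elt (α ++ U.act g (γ.drop β.length))
        (U.pathSrc (U.act g (γ.drop β.length)) ∩ U.coc g (γ.drop β.length) • B)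
        (U.coc g (γ.drop β.length) * h) δ (s.ext_right t h1)
    else if h2 : β = γ ++ β.drop γ.length ∧ β.drop γ.length ≠ [] ∧
        U.pathRng (β.drop γ.length) ⊆ B then
      elt α
        (A ∩ (g * (U.coc h⁻¹ (β.drop γ.length))⁻¹) • U.pathSrc (U.act h⁻¹ (β.drop γ.length)))
        (g * (U.coc h⁻¹ (β.drop γ.length))⁻¹) (δ ++ U.act h⁻¹ (β.drop γ.length))
        (s.ext_left t h2)
    else if h3 : γ = β ∧ (A ∩ g • B).Nonempty then
      elt α (A ∩ g • B) (g * h) δ (s.ext_same t h3)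
    else zero

noncomputable instance : Mul (Semi U) := ⟨mul⟩

/-- `(α, A, g, β)* = (β, g⁻¹ · A, g⁻¹, α)`. -/
instance : Star (Semi U) :=
  ⟨fun x => match x with
    | zero => zero
    | elt α A g β h => elt β (g⁻¹ • A) g⁻¹ α h.star⟩

/-! The semigroup laws are proved by letting the elements act as partial bijections. -/

/-- The first vertex of the word `ε` followed by the vertex `v`. -/
def hd (U : SelfSimilarUltragraph G V E) : List E → V → V
  | [], v => v
  | e :: _, _ => U.rng e

lemma hd_append (ε μ : List E) (v : V) (hε : ε ≠ []) (w : V) : hd U (ε ++ μ) v = hd U ε w := by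
  cases ε with
  | nil => exact absurd rfl hε
  | cons e l => rfl

lemma hd_act (g : G) (ε : List E) (v : V) : hd U (U.act g ε) (U.coc g ε • v) = g • hd U ε v := by
  cases ε with
  | nil => rfl
  | cons e l => exact U.rng_smul g e

lemma pathRng_subset {ε : List E} (hε : ε ≠ []) (v : V) (A : Set V) :
    U.pathRng ε ⊆ A ↔ hd U ε v ∈ A := by
  cases ε with
  | nil => exact absurd rfl hε
  | cons e l => simp [Ultragraph.pathRng, hd]

lemma smul_pathRng_subset {ε : List E} (hε : ε ≠ []) (v : V) (g : G) (A : Set V) :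
    g • U.pathRng ε ⊆ A ↔ g • hd U ε v ∈ A := by
  cases ε with
  | nil => exact absurd rfl hε
  | cons e l => simp [Ultragraph.pathRng, hd]

/-- The partial bijection of an element of the semigroup, as a relation. -/
def Rel : Semi U → List E × V × G → List E × V × G → Prop
  | zero, _, _ => False
  | elt α A g β _, x, y => ∃ ε, x.1 = β ++ ε ∧ g • hd U ε x.2.1 ∈ A ∧
      y = (α ++ U.act g ε, U.coc g ε • x.2.1, U.coc g ε * x.2.2)

lemma rel_fun {s : Semi U} {x y z : List E × V × G} (h1 : s.Rel x y) (h2 : s.Rel x z) :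
    y = z := by
  cases s with
  | zero => exact h1.elim
  | elt α A g β h =>
    obtain ⟨ε, hx, -, rfl⟩ := h1
    obtain ⟨ε', hx', -, rfl⟩ := h2
    obtain rfl : ε = ε' := List.append_cancel_left (hx.symm.trans hx')
    rfl

lemma star_star (s : Semi U) : star (star s) = s := by
  cases s with
  | zero => rfl
  | elt α A g β h =>
    change elt α (g⁻¹⁻¹ • g⁻¹ • A) g⁻¹⁻¹ β _ = elt α A g β h
    congr 1
    · simp
    · simp

lemma rel_star_of {s : Semi U} {x y : List E × V × G} (h : s.Rel x y) : (star s).Rel y x := by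
  cases s with
  | zero => exact h.elim
  | elt α A g β hv =>
    obtain ⟨ε, hx, hA, rfl⟩ := h
    refine ⟨U.act g ε, rfl, ?_, ?_⟩
    · rw [hd_act]
      exact Set.smul_mem_smul_set hA
    · obtain ⟨x1, x2, x3⟩ := x
      simp only at hx
      simp [act_inv_act, coc_inv_act, hx]

lemma rel_star {s : Semi U} {x y : List E × V × G} : (star s).Rel y x ↔ s.Rel x y :=
  ⟨fun h => by simpa [star_star] using rel_star_of h, rel_star_of⟩

lemma rel_inj {s : Semi U} {x y z : List E × V × G} (h1 : s.Rel x z) (h2 : s.Rel y z) :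
    x = y := rel_fun (rel_star.2 h1) (rel_star.2 h2)

lemma rel_base {α β : List E} {A : Set V} {g : G} (h : U.Valid α A g β) {v : V} (hv : g • v ∈ A) :
    (elt α A g β h).Rel (β, v, 1) (α, g • v, g) :=
  ⟨[], by simp, hv, by simp⟩

lemma rel_ext {s t : Semi U} (h : ∀ x y, s.Rel x y ↔ t.Rel x y) : s = t := by
  cases s with
  | zero =>
    cases t with
    | zero => rfl
    | elt γ B k δ ht =>
      obtain ⟨w, hw⟩ := ht.nonempty
      exact ((h _ _).2 (rel_base ht (v := k⁻¹ • w) (by simpa using hw))).elim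
  | elt α A g β hs =>
    cases t with
    | zero =>
      obtain ⟨w, hw⟩ := hs.nonempty
      exact ((h _ _).1 (rel_base hs (v := g⁻¹ • w) (by simpa using hw))).elim
    | elt γ B k δ ht =>
      obtain ⟨v, hv⟩ := hs.nonempty
      obtain ⟨w, hw⟩ := ht.nonempty
      have h1 : ∀ v, v ∈ A → ∃ ε, β = δ ++ ε ∧ k • hd U ε (g⁻¹ • v) ∈ B ∧
          α = γ ++ U.act k ε ∧ g = U.coc k ε := by
        intro v hv
        obtain ⟨ε, h1, h2, h3⟩ := (h _ _).1 (rel_base hs (v := g⁻¹ • v) (by simpa using hv))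
        simp only [Prod.mk.injEq, mul_one] at h3
        exact ⟨ε, h1, h2, h3.1, h3.2.2⟩
      have h2 : ∀ v, v ∈ B → ∃ ε, δ = β ++ ε ∧ g • hd U ε (k⁻¹ • v) ∈ A := by
        intro v hv
        obtain ⟨ε, h1, h2, h3⟩ := (h _ _).2 (rel_base ht (v := k⁻¹ • v) (by simpa using hv))
        exact ⟨ε, h1, h2⟩
      obtain ⟨ε, e1, -, e2, e3⟩ := h1 v hv
      obtain ⟨ε', e1', -⟩ := h2 w hw
      have hε : ε = [] := by
        have : β.length = β.length + ε'.length + ε.length := by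
          conv_lhs => rw [e1, e1']
          simp [add_assoc]
        exact List.eq_nil_of_length_eq_zero (by omega)
      subst hε
      simp only [List.append_nil, act_nil, coc_nil] at e1 e2 e3
      subst e1 e2 e3
      have hAB : A = B := by
        ext u
        constructor
        · intro hu
          obtain ⟨ε, e1, e2, -⟩ := h1 u hu
          obtain rfl : ε = [] := by simpa using e1
          simpa [hd] using e2
        · intro hu
          obtain ⟨ε, e1, e2⟩ := h2 u hu
          obtain rfl : ε = [] := by simpa using e1
          simpa [hd] using e2
      subst hAB
      rfl

lemma mul_ext_right {α β δ ε : List E} {A B : Set V} {g h : G}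
    (s : U.Valid α A g β) (t : U.Valid (β ++ ε) B h δ)
    (hc : ε ≠ [] ∧ g • U.pathRng ε ⊆ A) :
    elt α A g β s * elt (β ++ ε) B h δ t = elt _ _ _ _ (s.ext_right t ⟨rfl, hc⟩) := by
  change mul _ _ = _
  simp only [mul]
  rw [dif_pos (by simpa using hc)]
  simp only [List.drop_left]

lemma mul_ext_left {α γ δ ε : List E} {A B : Set V} {g h : G}
    (s : U.Valid α A g (γ ++ ε)) (t : U.Valid γ B h δ)
    (hc : ε ≠ [] ∧ U.pathRng ε ⊆ B) :
    elt α A g (γ ++ ε) s * elt γ B h δ t = elt _ _ _ _ (s.ext_left t ⟨rfl, hc⟩) := by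
  change mul _ _ = _
  simp only [mul]
  rw [dif_neg (by simp [hc.1]), dif_pos (by simpa using hc)]
  simp only [List.drop_left]

lemma mul_ext_same {α β δ : List E} {A B : Set V} {g h : G}
    (s : U.Valid α A g β) (t : U.Valid β B h δ) (hc : (A ∩ g • B).Nonempty) :
    elt α A g β s * elt β B h δ t = elt _ _ _ _ (s.ext_same t ⟨rfl, hc⟩) := by
  change mul _ _ = _
  simp only [mul]
  rw [dif_neg (by simp), dif_neg (by simp), dif_pos (by simpa using hc)]

lemma mul_eq_zero {α β γ δ : List E} {A B : Set V} {g h : G}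
    (s : U.Valid α A g β) (t : U.Valid γ B h δ)
    (h1 : ∀ ε, γ = β ++ ε → ε ≠ [] → ¬ g • U.pathRng ε ⊆ A)
    (h2 : ∀ ε, β = γ ++ ε → ε ≠ [] → ¬ U.pathRng ε ⊆ B)
    (h3 : γ = β → ¬ (A ∩ g • B).Nonempty) :
    elt α A g β s * elt γ B h δ t = zero := by
  change mul _ _ = _
  simp only [mul]
  rw [dif_neg (fun h => h1 _ h.1 h.2.1 h.2.2), dif_neg (fun h => h2 _ h.1 h.2.1 h.2.2),
    dif_neg (fun h => h3 h.1 h.2)]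

lemma rel_mul_aux {α β γ δ : List E} {A B : Set V} {g h : G}
    (s : U.Valid α A g β) (t : U.Valid γ B h δ) (x z : List E × V × G) :
    (∃ y, (elt γ B h δ t).Rel x y ∧ (elt α A g β s).Rel y z) ↔
      ∃ ε ε', x.1 = δ ++ ε ∧ h • hd U ε x.2.1 ∈ B ∧ γ ++ U.act h ε = β ++ ε' ∧
        g • hd U ε' (U.coc h ε • x.2.1) ∈ A ∧
        z = (α ++ U.act g ε', U.coc g ε' • U.coc h ε • x.2.1, U.coc g ε' * (U.coc h ε * x.2.2)) := by
  constructor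
  · rintro ⟨y, ⟨ε, h1, h2, rfl⟩, ε', h3, h4, h5⟩
    exact ⟨ε, ε', h1, h2, h3, h4, h5⟩
  · rintro ⟨ε, ε', h1, h2, h3, h4, h5⟩
    exact ⟨_, ⟨ε, h1, h2, rfl⟩, ε', h3, h4, h5⟩

lemma rel_mul (s t : Semi U) (x z : List E × V × G) :
    (s * t).Rel x z ↔ ∃ y, t.Rel x y ∧ s.Rel y z := by
  cases s with
  | zero =>
    constructor
    · exact False.elim
    · rintro ⟨y, -, h⟩
      exact h.elim
  | elt α A g β s =>
  cases t with
  | zero =>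
    constructor
    · exact False.elim
    · rintro ⟨y, h, -⟩
      exact h.elim
  | elt γ B h δ t =>
  obtain ⟨p, v, k⟩ := x
  rw [rel_mul_aux]
  by_cases c1 : ∃ ε, γ = β ++ ε ∧ ε ≠ []
  · obtain ⟨η, rfl, hη⟩ := c1
    by_cases c2 : g • U.pathRng η ⊆ A
    · rw [mul_ext_right s t ⟨hη, c2⟩]
      have hB : U.coc g η • B ⊆ U.pathSrc (U.act g η) := by
        rw [pathSrc_act]
        have := t.subset.trans Set.inter_subset_left
        rw [Ultragraph.pathSrc_append _ _ hη] at this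
        exact Set.smul_set_mono this
      simp only [Rel, Set.inter_eq_right.2 hB, mul_smul, Set.smul_mem_smul_set_iff]
      refine exists_congr fun ε => ?_
      simp only [List.append_assoc, List.append_cancel_left_eq, act_mul, coc_mul, mul_smul]
      constructor
      · rintro ⟨h1, h2, rfl⟩
        refine ⟨_, h1, h2, rfl, ?_, ?_⟩
        · rw [hd_append _ _ _ hη v]
          exact (smul_pathRng_subset hη v g A).1 c2
        · simp [act_append, coc_append, mul_assoc]
      · rintro ⟨ε', h1, h2, rfl, h4, rfl⟩
        refine ⟨h1, h2, ?_⟩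
        simp [act_append, coc_append, mul_assoc]
    · rw [mul_eq_zero s t]
      · simp only [Rel, false_iff, not_exists]
        rintro ε ε' ⟨h1, h2, h3, h4, h5⟩
        rw [List.append_assoc, List.append_cancel_left_eq] at h3
        subst h3
        rw [hd_append _ _ _ hη v] at h4
        exact c2 ((smul_pathRng_subset hη v g A).2 h4)
      · intro ε h1 _
        rw [List.append_cancel_left_eq] at h1
        exact h1 ▸ c2
      · intro ε h1 h2
        simp [hη] at h1
      · intro h1
        simp [hη] at h1
  by_cases c1' : ∃ ε, β = γ ++ ε ∧ ε ≠ []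
  · obtain ⟨η, rfl, hη⟩ := c1'
    by_cases c2 : U.pathRng η ⊆ B
    · rw [mul_ext_left s t ⟨hη, c2⟩]
      simp only [Rel, Set.inter_eq_left.2 (s.subset_ext h ⟨rfl, hη⟩)]
      have key : ∀ ε' : List E, U.act h (U.act h⁻¹ η ++ ε') =
          η ++ U.act (U.coc h⁻¹ η)⁻¹ ε' := by
        intro ε'
        rw [act_append, act_act_inv, coc_act_inv]
      constructor
      · rintro ⟨ε, h1, h2, rfl⟩
        refine ⟨U.act h⁻¹ η ++ ε, U.act (U.coc h⁻¹ η)⁻¹ ε, by simpa using h1, ?_, ?_, ?_, ?_⟩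
        · rw [hd_append _ _ _ (U.act_ne_nil hη) (U.coc h⁻¹ η • v), hd_act, smul_inv_smul]
          exact (pathRng_subset hη v B).1 c2
        · rw [key, List.append_assoc]
        · rw [coc_append, coc_act_inv, hd_act, ← mul_smul]
          exact h2
        · simp [act_mul, coc_mul, coc_append, coc_act_inv, mul_smul, mul_assoc]
      · rintro ⟨ε, ε', h1, h2, h3, h4, rfl⟩
        rw [List.append_assoc, List.append_cancel_left_eq] at h3
        have h3' : ε = U.act h⁻¹ η ++ U.act (U.coc h⁻¹ η) ε' := by
          rw [← act_append, ← h3, act_inv_act]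
        have h3'' : ε' = U.act (U.coc h⁻¹ η)⁻¹ (U.act (U.coc h⁻¹ η) ε') := by
          rw [act_inv_act]
        generalize U.act (U.coc h⁻¹ η) ε' = μ at h3' h3''
        subst h3' h3''
        refine ⟨μ, by simpa using h1, ?_, ?_⟩
        · rw [coc_append, coc_act_inv, hd_act, ← mul_smul] at h4
          exact h4
        · simp [act_mul, coc_mul, coc_append, coc_act_inv, mul_smul, mul_assoc]
    · rw [mul_eq_zero s t]
      · simp only [Rel, false_iff, not_exists]
        rintro ε ε' ⟨h1, h2, h3, h4, h5⟩
        rw [List.append_assoc, List.append_cancel_left_eq] at h3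
        rw [← hd_act, h3, hd_append _ _ _ hη v] at h2
        exact c2 ((pathRng_subset hη v B).2 h2)
      · intro ε h1 h2
        simp [hη] at h1
      · intro ε h1 _
        rw [List.append_cancel_left_eq] at h1
        exact h1 ▸ c2
      · intro h1
        simp [hη] at h1
  by_cases c3 : γ = β
  · subst c3
    have key : ∀ ε : List E, (h • hd U ε v ∈ B ∧ g • hd U (U.act h ε) (U.coc h ε • v) ∈ A) ↔
        (g * h) • hd U ε v ∈ A ∩ g • B := by
      intro ε
      rw [hd_act, Set.mem_inter_iff, mul_smul, Set.smul_mem_smul_set_iff, and_comm]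
    by_cases c2 : (A ∩ g • B).Nonempty
    · rw [mul_ext_same s t c2]
      simp only [Rel]
      refine exists_congr fun ε => ?_
      rw [← key]
      simp only [List.append_cancel_left_eq]
      constructor
      · rintro ⟨h1, ⟨h2, h3⟩, rfl⟩
        exact ⟨_, h1, h2, rfl, h3, by simp [act_mul, coc_mul, mul_smul, mul_assoc]⟩
      · rintro ⟨ε', h1, h2, rfl, h3, rfl⟩
        exact ⟨h1, ⟨h2, h3⟩, by simp [act_mul, coc_mul, mul_smul, mul_assoc]⟩
    · rw [mul_eq_zero s t]
      · simp only [Rel, false_iff, not_exists]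
        rintro ε ε' ⟨h1, h2, h3, h4, h5⟩
        rw [List.append_cancel_left_eq] at h3
        subst h3
        exact c2 ⟨_, (key ε).1 ⟨h2, h4⟩⟩
      · intro ε h1 h2
        exact absurd (by simpa using h1) h2
      · intro ε h1 h2
        exact absurd (by simpa using h1) h2
      · exact fun _ => c2
  · rw [mul_eq_zero s t]
    · simp only [Rel, false_iff, not_exists]
      rintro ε ε' ⟨h1, h2, h3, h4, h5⟩
      rcases List.append_eq_append_iff.1 h3 with ⟨a, ha, -⟩ | ⟨a, ha, -⟩
      · by_cases h0 : a = []
        · subst h0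
          exact c3 (by simpa using ha.symm)
        · exact c1' ⟨a, ha, h0⟩
      · by_cases h0 : a = []
        · subst h0
          exact c3 (by simpa using ha)
        · exact c1 ⟨a, ha, h0⟩
    · exact fun ε h1 h2 _ => c1 ⟨ε, h1, h2⟩
    · exact fun ε h1 h2 _ => c1' ⟨ε, h1, h2⟩
    · exact fun h1 => absurd h1 c3

noncomputable instance : InverseSemigroupWithZero (Semi U) where
  mul_assoc a b c := rel_ext fun x z => by
    simp only [rel_mul]
    constructor
    · rintro ⟨y, h1, w, h2, h3⟩
      exact ⟨w, ⟨y, h1, h2⟩, h3⟩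
    · rintro ⟨w, ⟨y, h1, h2⟩, h3⟩
      exact ⟨y, h1, w, h2, h3⟩
  zero_mul a := rfl
  mul_zero a := by cases a <;> rfl
  mul_star_mul s := rel_ext fun x z => by
    simp only [rel_mul, rel_star]
    constructor
    · rintro ⟨y, h1, w, h2, h3⟩
      rwa [rel_inj h1 h2]
    · intro h
      exact ⟨z, h, x, h, h⟩
  star_mul_star s := rel_ext fun x z => by
    simp only [rel_mul, rel_star]
    constructor
    · rintro ⟨y, h1, w, h2, h3⟩
      rwa [rel_fun h1 h2]
    · intro h
      exact ⟨z, h, x, h, h⟩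
  star_unique s t hs ht := rel_ext fun x y => by
    rw [rel_star]
    constructor
    · intro h
      have h' := h
      rw [← ht, rel_mul] at h'
      obtain ⟨a, h1, h2⟩ := h'
      obtain ⟨b, h2, h3⟩ := (rel_mul _ _ _ _).1 h2
      rwa [rel_fun h1 h, rel_inj h3 h] at h2
    · intro h
      have h' := h
      rw [← hs, rel_mul] at h'
      obtain ⟨a, h1, h2⟩ := h'
      obtain ⟨b, h2, h3⟩ := (rel_mul _ _ _ _).1 h2
      rwa [rel_fun h1 h, rel_inj h3 h] at h2

end Semi

end SelfSimilarUltragraph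

/-! Two germs over different filters are always separated, because the tight spectrum is Hausdorff.
The question is whether distinct germs `[s, F]` and `[t, F]` over one filter can be separated. They
coincide over exactly those filters that contain an idempotent on which `s` and `t` agree. If
finitely many such idempotents dominate all nonzero ones below `s* s` and `t* t`, excluding these
finitely many gives a neighbourhood of `F` over which the germs never meet
(`t2Space_tightGroupoid`).

Through the faithful action `Rel` by partial bijections, `s` and `t` agree on an idempotent `e`
below `s* s` exactly when `s* t` fixes the domain of `e` pointwise. For an element `(α, A, g, α)`
with `g ≠ 1`, the nonzero idempotents below it live on paths `αε` with `ε` strongly fixed by `g` and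
`r(ε) ⊆ A` (`exists_of_mul_eq`). Each lies below the idempotent of `αμ`, where `μ` is the minimal
strongly fixed prefix of `ε`. Finitely many minimal paths therefore give finitely many dominating
idempotents.

Conversely, suppose `A SF_g` has infinitely many minimal elements. Each gives an ultrafilter over
which `(ω, A, g, ω)` and `(ω, A, 1, ω)` have the same germ. In a Hausdorff groupoid the germs still
agree at the limit along a nonprincipal ultrafilter of indices (`exists_mul_eq_mul_of_t2Space`). One
idempotent then witnesses the agreement for infinitely many indices, but its path has only one
minimal strongly fixed prefix, so it is compatible with only one index. -/

namespace InverseSemigroupWithZero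

variable {S : Type*} [InverseSemigroupWithZero S]

/-! ### Separation of filters and of germs -/

lemma isIdempotentElem_star_mul (s : S) : IsIdempotentElem (star s * s) := by
  unfold IsIdempotentElem
  rw [← mul_assoc, star_mul_star]

/-- Membership in a filter passes from `e` to any idempotent `f` with `f e = e`. -/
lemma IsFilter.mem_of_mul_eq {F : Set S} (hF : IsFilter F) {e f : S} (he : e ∈ F)
    (hf : IsIdempotentElem f) (h : f * e = e) : f ∈ F :=
  hF.up_mem e he f hf ⟨e, hF.idem e he, h.symm⟩

lemma isOpen_basicNhd {e : S} {T : Finset S} (he : IsIdempotentElem e)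
    (hT : ∀ f ∈ T, IsIdempotentElem f) : IsOpen (basicNhd e T) :=
  TopologicalSpace.isOpen_generateFrom_of_mem ⟨e, T, he, hT, rfl⟩

/-- A basic open set must prescribe a member, and the semilattice need not have a top element; any
`f ∈ F'` serves to define the neighbourhood of `F'` that excludes `e`. -/
lemma FilterSpace.exists_separation {F F' : FilterSpace S} {e : S} (he : e ∈ F.1)
    (he' : e ∉ F'.1) :
    ∃ N N' : Set (FilterSpace S), IsOpen N ∧ IsOpen N' ∧ F ∈ N ∧ F' ∈ N' ∧ Disjoint N N' := by
  obtain ⟨f, hf⟩ := F'.2.1.nonempty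
  refine ⟨basicNhd e ∅, basicNhd f {e}, isOpen_basicNhd (F.2.1.idem e he) (by simp),
    isOpen_basicNhd (F'.2.1.idem f hf) (by simpa using F.2.1.idem e he), ⟨he, by simp⟩,
    ⟨hf, by simpa using he'⟩, ?_⟩
  rw [Set.disjoint_left]
  exact fun K h h' => h'.2 e (by simp) h.1

instance : T2Space (FilterSpace S) := by
  refine ⟨fun F F' hne => ?_⟩
  by_cases h : F.1 ⊆ F'.1
  · have h' : ¬ F'.1 ⊆ F.1 := fun h' => hne (Subtype.ext (h.antisymm h'))
    obtain ⟨e, he, he'⟩ := Set.not_subset.1 h'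
    obtain ⟨N, N', h1, h2, h3, h4, h5⟩ := FilterSpace.exists_separation he he'
    exact ⟨N', N, h2, h1, h4, h3, h5.symm⟩
  · obtain ⟨e, he, he'⟩ := Set.not_subset.1 h
    exact FilterSpace.exists_separation he he'

instance : T2Space (TightSpectrum S) :=
  inferInstanceAs (T2Space {F : FilterSpace S // F ∈ closure (ultrafilters S)})

lemma TightSpectrum.isFilter (F : TightSpectrum S) : IsFilter F.carrier := F.1.2.1

lemma TightSpectrum.zero_notMem (F : TightSpectrum S) : (0 : S) ∉ F.carrier := F.1.2.2

lemma isOpen_germSet (s : S) {W : Set (TightSpectrum S)} (hW : IsOpen W) :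
    IsOpen (germSet s W) :=
  TopologicalSpace.isOpen_generateFrom_of_mem ⟨s, W, hW, rfl⟩

/-- This form does not depend on the representative, and each condition concerns `W` or membership
of a single idempotent in the filter, so it can be transported along limits of filters. -/
lemma mem_germSet {p : GermPair S} {s : S} {W : Set (TightSpectrum S)} :
    (Quotient.mk (germSetoid S) p : TightGroupoid S) ∈ germSet s W ↔
      p.filter ∈ W ∧ star s * s ∈ p.filter.carrier ∧
        ∃ e ∈ p.filter.carrier, p.elt * e = s * e := by
  constructor
  · rintro ⟨q, rfl, hq, h⟩
    obtain ⟨h1, e, he, h2⟩ := Quotient.exact h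
    exact ⟨h1 ▸ hq, h1 ▸ q.mem, e, he, h2⟩
  · rintro ⟨h1, h2, h3⟩
    exact ⟨⟨s, p.filter, h2⟩, rfl, h1, Quotient.sound ⟨rfl, h3⟩⟩

/-- The tight groupoid is Hausdorff if for all `s`, `t` the idempotents below `s* s t* t` on which
`s` and `t` agree are dominated by finitely many idempotents on which `s` and `t` agree. -/
theorem t2Space_tightGroupoid
    (h : ∀ s t : S, ∃ T : Finset S, (∀ f ∈ T, IsIdempotentElem f ∧ s * f = t * f) ∧
      ∀ e : S, IsIdempotentElem e → e ≠ 0 → star s * s * e = e → star t * t * e = e →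
        s * e = t * e → ∃ f ∈ T, f * e = e) :
    T2Space (TightGroupoid S) := by
  refine ⟨fun x y => ?_⟩
  induction x using Quotient.ind with | _ p
  induction y using Quotient.ind with | _ q
  intro hne
  by_cases hpq : p.filter = q.filter
  · obtain ⟨T, hT, hcov⟩ := h p.elt q.elt
    have hW : IsOpen {F : TightSpectrum S | F.1 ∈ basicNhd (star p.elt * p.elt) T} :=
      (isOpen_basicNhd (isIdempotentElem_star_mul _) fun f hf => (hT f hf).1).preimage
        continuous_subtype_val
    -- An `f ∈ T` inside the common filter would already identify the two germs.
    have hp : p.filter.1 ∈ basicNhd (star p.elt * p.elt) T :=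
      ⟨p.mem, fun f hf hfp => hne (Quotient.sound ⟨hpq, f, hfp, (hT f hf).2⟩)⟩
    refine ⟨_, _, isOpen_germSet p.elt hW, isOpen_germSet q.elt hW,
      ⟨p, rfl, hp, rfl⟩, ⟨q, rfl, ?_, rfl⟩, ?_⟩
    · exact (hpq ▸ hp : q.filter.1 ∈ basicNhd (star p.elt * p.elt) T)
    · rw [Set.disjoint_left]
      rintro _ ⟨p', hp', hpW, rfl⟩ hx
      obtain ⟨-, hq, e, he, hpe⟩ := mem_germSet.1 hx
      have hF := p'.filter.isFilter
      have hp'' := p'.mem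
      rw [hp'] at hpe hp''
      have hsi := isIdempotentElem_star_mul p.elt
      have hti := isIdempotentElem_star_mul q.elt
      have hei := hF.idem e he
      -- Cutting `e` down by both domain idempotents keeps it in the filter, hence nonzero, and
      -- keeps `s` and `t` in agreement.
      have hmem := hF.mul_mem _ (hF.mul_mem _ he _ hp'') _ hq
      obtain ⟨f, hfT, hf⟩ := hcov _ (hF.idem _ hmem)
        (fun h0 => p'.filter.zero_notMem (h0 ▸ hmem))
        (by rw [← mul_assoc _ (e * _), ← mul_assoc _ e, idem_comm hsi hei, mul_assoc e, hsi.eq])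
        (by rw [idem_comm hti (hF.idem _ hmem), mul_assoc _ _ (star q.elt * q.elt), hti.eq])
        (by rw [mul_assoc e, ← mul_assoc _ e, hpe, mul_assoc])
      exact hpW.2 f hfT (hF.mem_of_mul_eq hmem (hT f hfT).1 hf)
  · obtain ⟨W, W', hW, hW', h1, h2, h3⟩ := t2_separation hpq
    refine ⟨_, _, isOpen_germSet p.elt hW, isOpen_germSet q.elt hW',
      ⟨p, rfl, h1, rfl⟩, ⟨q, rfl, h2, rfl⟩, ?_⟩
    rw [Set.disjoint_left]
    intro x hx hx'
    induction x using Quotient.ind with | _ r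
    exact Set.disjoint_left.1 h3 (mem_germSet.1 hx).1 (mem_germSet.1 hx').1

/-! ### Ultrafilters and limits of filters -/

/-- Every nonzero idempotent belongs to an ultrafilter. -/
lemma exists_mem_ultrafilters {e : S} (he : IsIdempotentElem e) (h0 : e ≠ 0) :
    ∃ F ∈ ultrafilters S, e ∈ F.1 := by
  have hprin : IsFilter {f : S | IsIdempotentElem f ∧ f * e = e} := by
    refine ⟨⟨e, he, he.eq⟩, fun f hf => hf.1, ?_, ?_⟩
    · rintro f ⟨hf, hfe⟩ k ⟨hk, hke⟩
      exact ⟨isIdempotentElem_mul hf hk, by rw [mul_assoc, hke, hfe]⟩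
    · rintro f ⟨hf, hfe⟩ k hk ⟨i, -, rfl⟩
      refine ⟨hk, ?_⟩
      rw [← hfe, ← mul_assoc, ← mul_assoc, hk.eq]
  obtain ⟨M, hM, hmax⟩ := zorn_subset_nonempty {F : Set S | IsFilter F ∧ (0 : S) ∉ F} (by
    intro c hc hchain hne
    refine ⟨⋃₀ c, ⟨⟨?_, ?_, ?_, ?_⟩, ?_⟩, fun F hF => Set.subset_sUnion_of_mem hF⟩
    · obtain ⟨F, hF⟩ := hne
      obtain ⟨f, hf⟩ := (hc hF).1.nonempty
      exact ⟨f, F, hF, hf⟩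
    · rintro f ⟨F, hF, hf⟩
      exact (hc hF).1.idem f hf
    · rintro f ⟨F, hF, hf⟩ k ⟨K, hK, hk⟩
      rcases hchain.total hF hK with h | h
      · exact ⟨K, hK, (hc hK).1.mul_mem f (h hf) k hk⟩
      · exact ⟨F, hF, (hc hF).1.mul_mem f hf k (h hk)⟩
    · rintro f ⟨F, hF, hf⟩ k hk hle
      exact ⟨F, hF, (hc hF).1.up_mem f hf k hk hle⟩
    · rintro ⟨F, hF, hf⟩
      exact (hc hF).2 hf) _ ⟨hprin, fun h => h0 (by simpa using h.2.symm)⟩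
  exact ⟨⟨M, hmax.prop⟩, fun F' h => (hmax.eq_of_subset F'.2 h).symm, hM ⟨he, he.eq⟩⟩

variable {ι : Type*} (𝒰 : Ultrafilter ι)

/-- The limit of a family of filters along an ultrafilter on the index set. -/
def FilterSpace.ultraLimit (F : ι → FilterSpace S) {e : S} (he : ∀ i, e ∈ (F i).1) :
    FilterSpace S :=
  ⟨{f | ∀ᶠ i in (𝒰 : Filter ι), f ∈ (F i).1},
    -- The common member `e` is what keeps the limit from being empty.
    { nonempty := ⟨e, Filter.Eventually.of_forall he⟩
      idem := fun f hf => by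
        obtain ⟨i, hi⟩ := Filter.Eventually.exists hf
        exact (F i).2.1.idem f hi
      mul_mem := fun f hf k hk => by
        filter_upwards [hf, hk] with i h1 h2 using (F i).2.1.mul_mem f h1 k h2
      up_mem := fun f hf k hk hle => by
        filter_upwards [hf] with i h1 using (F i).2.1.up_mem f h1 k hk hle },
    fun h => by
      obtain ⟨i, hi⟩ := Filter.Eventually.exists h
      exact (F i).2.2 hi⟩

/-- Because `𝒰` is an ultrafilter, an idempotent missing from the limit is missing from almost every
`F i`, so the excluded idempotents of a basic set cause no trouble. -/
lemma FilterSpace.tendsto_ultraLimit (F : ι → FilterSpace S) {e : S}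
    (he : ∀ i, e ∈ (F i).1) :
    Filter.Tendsto F 𝒰 (nhds (FilterSpace.ultraLimit 𝒰 F he)) := by
  refine TopologicalSpace.tendsto_nhds_generateFrom_iff.2 ?_
  rintro _ ⟨f, T, -, -, rfl⟩ ⟨h1, h2⟩
  have h3 : ∀ᶠ i in (𝒰 : Filter ι), ∀ k ∈ T, k ∉ (F i).1 :=
    (Filter.eventually_all_finset T).2 fun k hk => Ultrafilter.eventually_not.2 (h2 k hk)
  exact Filter.Eventually.and h1 h3

/-- In a Hausdorff tight groupoid, if `s` and `t` agree on an element of `F i` for each `i`, then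
they agree on an element of the limit of `F` along any ultrafilter. -/
theorem exists_mul_eq_mul_of_t2Space [T2Space (TightGroupoid S)] (F : ι → FilterSpace S)
    (hF : ∀ i, F i ∈ ultrafilters S) {s t : S} (hs : ∀ i, star s * s ∈ (F i).1)
    (ht : ∀ i, star t * t ∈ (F i).1) (hst : ∀ i, ∃ e ∈ (F i).1, s * e = t * e) :
    ∃ e, (∀ᶠ i in (𝒰 : Filter ι), e ∈ (F i).1) ∧ s * e = t * e := by
  have hlim := FilterSpace.tendsto_ultraLimit 𝒰 F hs
  have hcl : FilterSpace.ultraLimit 𝒰 F hs ∈ closure (ultrafilters S) :=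
    mem_closure_of_tendsto hlim (Filter.Eventually.of_forall hF)
  let L : TightSpectrum S := ⟨FilterSpace.ultraLimit 𝒰 F hs, hcl⟩
  let K : ι → TightSpectrum S := fun i => ⟨F i, subset_closure (hF i)⟩
  have hK : Filter.Tendsto K 𝒰 (nhds L) := tendsto_subtype_rng.2 hlim
  -- For fixed `u`, the germ `[u, ·]` varies continuously; applied to `s` and to `t`, it yields two
  -- limits of one and the same family of germs.
  have key : ∀ (u : S) (hu : ∀ i, star u * u ∈ (F i).1)
      (hL : star u * u ∈ L.carrier), Filter.Tendsto (β := TightGroupoid S)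
      (fun i => (Quotient.mk (germSetoid S) ⟨u, K i, hu i⟩ : TightGroupoid S)) 𝒰
      (nhds (Quotient.mk (germSetoid S) ⟨u, L, hL⟩ : TightGroupoid S)) := by
    intro u hu hL
    refine TopologicalSpace.tendsto_nhds_generateFrom_iff.2 ?_
    rintro _ ⟨w, W, hW, rfl⟩ hmem
    obtain ⟨h1, h2, e, h3, h4⟩ := mem_germSet.1 hmem
    filter_upwards [hK.eventually (hW.mem_nhds h1), h2, h3] with i i1 i2 i3
    exact mem_germSet.2 ⟨i1, i2, e, i3, h4⟩
  have hs' := key s hs (Filter.Eventually.of_forall hs)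
  have ht' := key t ht (Filter.Eventually.of_forall ht)
  have heq : (fun i => (Quotient.mk (germSetoid S) ⟨s, K i, hs i⟩ : TightGroupoid S)) =
      fun i => Quotient.mk (germSetoid S) ⟨t, K i, ht i⟩ :=
    funext fun i => Quotient.sound ⟨rfl, hst i⟩
  rw [heq] at hs'
  obtain ⟨-, e, he, h⟩ := Quotient.exact (tendsto_nhds_unique (X := TightGroupoid S) hs' ht')
  exact ⟨e, he, h⟩

end InverseSemigroupWithZero

namespace SelfSimilarUltragraph

open scoped Pointwise
open InverseSemigroupWithZero

variable {G V E : Type*} [Group G] [MulAction G V] [MulAction G E]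
  {U : SelfSimilarUltragraph G V E}

/-! ### Minimal strongly fixed paths -/

lemma pathRng_append {ε : List E} (hε : ε ≠ []) (μ : List E) :
    U.pathRng (ε ++ μ) = U.pathRng ε := by
  cases ε with
  | nil => exact absurd rfl hε
  | cons e l => rfl

lemma pathSrc_nonempty {γ : List E} (hγ : γ ≠ []) : (U.pathSrc γ).Nonempty := by
  obtain rfl | ⟨m, e, rfl⟩ := γ.eq_nil_or_concat
  · exact absurd rfl hγ
  · rw [List.concat_eq_append, Ultragraph.pathSrc_concat]
    exact U.src_nonempty e

lemma pathRng_subset_pathSrc_of_isPath {γ ε : List E} (h : U.IsPath (γ ++ ε)) (hε : ε ≠ []) :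
    U.pathRng ε ⊆ U.pathSrc γ := by
  obtain rfl | ⟨m, e, rfl⟩ := γ.eq_nil_or_concat
  · exact Set.subset_univ _
  · obtain ⟨f, l, rfl⟩ := List.exists_cons_of_ne_nil hε
    rw [List.concat_eq_append] at h ⊢
    rw [Ultragraph.pathSrc_concat]
    have h' : U.IsPath ([e] ++ f :: l) := by
      rw [List.append_assoc] at h
      exact List.IsChain.right_of_append h
    simpa [Ultragraph.pathRng] using (List.isChain_cons_cons.1 h').1

/-- Minimality in `A SF_g` is minimality in `SF_g`, because subpaths share their range. -/
lemma minimalPaths_SFIn (A : Set V) (g : G) :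
    minimalPaths (U.SFIn A g) = {γ | γ ∈ minimalPaths (U.SF g) ∧ U.pathRng γ ⊆ A} := by
  ext γ
  constructor
  · rintro ⟨⟨h1, h2⟩, h3⟩
    refine ⟨⟨h1, fun τ hτ hp => h3 τ ⟨hτ, ?_⟩ hp⟩, h2⟩
    obtain ⟨μ, rfl⟩ := hp
    rwa [pathRng_append hτ.1] at h2
  · rintro ⟨⟨h1, h2⟩, h3⟩
    exact ⟨⟨h1, h3⟩, fun τ hτ hp => h2 τ hτ.1 hp⟩

lemma exists_minimalPaths_prefix {g : G} {ε : List E} (hε : ε ∈ U.SF g) :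
    ∃ μ ∈ minimalPaths (U.SF g), μ <+: ε := by
  induction hn : ε.length using Nat.strong_induction_on generalizing ε with
  | _ n ih =>
    by_cases hmin : ε ∈ minimalPaths (U.SF g)
    · exact ⟨ε, hmin, List.prefix_refl ε⟩
    · have : ∃ τ ∈ U.SF g, τ <+: ε ∧ τ ≠ ε := by
        by_contra! hcon
        exact hmin ⟨hε, hcon⟩
      obtain ⟨τ, h1, h2, h3⟩ := this
      obtain ⟨μ, h4, h5⟩ := ih τ.length
        (hn ▸ lt_of_le_of_ne h2.length_le fun h => h3 (h2.eq_of_length h)) h1 rfl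
      exact ⟨μ, h4, h5.trans h2⟩

/-- Minimality does not depend on `A`, so the set of minimal paths is monotone in `A`, which settles
intersections and differences. Unions work because the range of an edge is one vertex, which lies in
one of the two parts. -/
lemma finite_minimalPaths_SFIn {g : G}
    (hv : ∀ v : V, (minimalPaths (U.SFIn {v} g)).Finite)
    (he : ∀ e : E, (minimalPaths (U.SFIn (U.src e) g)).Finite) {A : Set V} (hA : U.Gen A) :
    (minimalPaths (U.SFIn A g)).Finite := by
  have mono : ∀ {A B : Set V}, A ⊆ B →
      minimalPaths (U.SFIn A g) ⊆ minimalPaths (U.SFIn B g) := by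
    intro A B hAB γ
    rw [minimalPaths_SFIn, minimalPaths_SFIn]
    exact fun h => ⟨h.1, h.2.trans hAB⟩
  induction hA with
  | empty =>
    convert Set.finite_empty
    refine Set.eq_empty_of_forall_notMem fun γ hγ => ?_
    obtain ⟨e, l, rfl⟩ := List.exists_cons_of_ne_nil hγ.1.1.1
    simpa [Ultragraph.pathRng] using hγ.1.2
  | singleton v => exact hv v
  | source e => exact he e
  | inter _ _ h1 _ => exact h1.subset (mono Set.inter_subset_left)
  | diff _ _ h1 _ => exact h1.subset (mono Set.sdiff_subset)
  | union _ _ h1 h2 =>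
    refine (h1.union h2).subset fun γ hγ => ?_
    obtain ⟨e, l, rfl⟩ := List.exists_cons_of_ne_nil hγ.1.1.1
    simp only [minimalPaths_SFIn, Ultragraph.pathRng, Set.mem_ofPred_eq, Set.mem_union,
      Set.singleton_subset_iff] at hγ ⊢
    exact hγ.2.imp (⟨hγ.1, ·⟩) (⟨hγ.1, ·⟩)

namespace Semi

/-! ### Idempotents as partial identities -/

/-- If `x ↦ y`, idempotency gives `y ↦ y`, and injectivity forces `x = y`. -/
lemma rel_eq_of_isIdempotentElem {e : Semi U} (he : IsIdempotentElem e) {x y : List E × V × G}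
    (h : e.Rel x y) : x = y := by
  have h1 : e.Rel y x := by
    rw [← star_eq_self he]
    exact rel_star.2 h
  have h2 := h
  rw [← he.eq, rel_mul] at h2
  obtain ⟨w, h3, h4⟩ := h2
  rw [rel_fun h3 h] at h4
  exact rel_inj h h4

lemma isIdempotentElem_of_rel {e : Semi U} (h : ∀ x y, e.Rel x y → x = y) :
    IsIdempotentElem e := by
  refine rel_ext fun x z => ?_
  rw [rel_mul]
  constructor
  · rintro ⟨y, h1, h2⟩
    rwa [h x y h1]
  · intro h1
    have := h x z h1
    subst this
    exact ⟨x, h1, h1⟩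

lemma mul_eq_right_iff {s e : Semi U} (he : IsIdempotentElem e) :
    s * e = e ↔ ∀ x, e.Rel x x → s.Rel x x := by
  constructor
  · intro h x hx
    have h2 := hx
    rw [← h, rel_mul] at h2
    obtain ⟨y, h3, h4⟩ := h2
    rwa [rel_fun h3 hx] at h4
  · intro h
    refine rel_ext fun x z => ?_
    rw [rel_mul]
    constructor
    · rintro ⟨y, h1, h2⟩
      obtain rfl := rel_eq_of_isIdempotentElem he h1
      rwa [rel_fun h2 (h _ h1)]
    · intro h1
      obtain rfl := rel_eq_of_isIdempotentElem he h1
      exact ⟨x, h1, h _ h1⟩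

/-- The idempotent `(γ, s(γ), 1, γ)` of a path `γ` of positive length. -/
def ofPath (γ : List E) (h : γ ≠ []) (hγ : U.IsPath γ) : Semi U :=
  elt γ (U.pathSrc γ) 1 γ ⟨hγ, hγ, U.gen_pathSrc h, pathSrc_nonempty h, by simp⟩

lemma rel_ofPath {γ : List E} (h : γ ≠ []) (hγ : U.IsPath γ) {x y : List E × V × G} :
    (ofPath γ h hγ).Rel x y ↔ x = y ∧ ∃ ε, x.1 = γ ++ ε ∧ hd U ε x.2.1 ∈ U.pathSrc γ := by
  obtain ⟨x1, x2, x3⟩ := x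
  constructor
  · rintro ⟨ε, rfl, h2, rfl⟩
    exact ⟨by simp [act_one, coc_one], ε, rfl, by simpa using h2⟩
  · rintro ⟨rfl, ε, rfl, h2⟩
    exact ⟨ε, rfl, by simpa using h2, by simp [act_one, coc_one]⟩

lemma isIdempotentElem_ofPath {γ : List E} (h : γ ≠ []) (hγ : U.IsPath γ) :
    IsIdempotentElem (ofPath γ h hγ) :=
  isIdempotentElem_of_rel fun _ _ hxy => ((rel_ofPath h hγ).1 hxy).1

lemma ofPath_ne_zero {γ : List E} (h : γ ≠ []) (hγ : U.IsPath γ) : ofPath γ h hγ ≠ 0 := by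
  intro h0
  cases h0

/-- The paths strongly fixed by `g` give idempotents below `(α, A, g, α)`. -/
lemma mul_ofPath_eq {α μ : List E} {A : Set V} {g : G} (hs : U.Valid α A g α) (hμ : μ ∈ U.SF g)
    (hA : U.pathRng μ ⊆ A) (hne : α ++ μ ≠ []) (hp : U.IsPath (α ++ μ)) :
    elt α A g α hs * ofPath (α ++ μ) hne hp = ofPath (α ++ μ) hne hp := by
  rw [mul_eq_right_iff (isIdempotentElem_ofPath _ _)]
  rintro ⟨x, v, k⟩ hx
  obtain ⟨-, ζ, rfl, -⟩ := (rel_ofPath hne hp).1 hx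
  obtain ⟨h0, h1, h2, h3⟩ := hμ
  -- `g` fixes `μ` and has cocycle `1` after it, so the tail `ζ` does not move.
  refine ⟨μ ++ ζ, List.append_assoc _ _ _, ?_, ?_⟩
  · rw [hd_append _ _ _ h0 v, ← hd_act, h2]
    exact (pathRng_subset h0 _ A).1 hA
  · simp [act_append, coc_append, h2, h3, act_one, coc_one]

/-- An idempotent fixes its base point `(ζ, k⁻¹ • v, 1) ↦ (η, v, k)`. The third coordinate forces `k
= 1` even when `G` does not act faithfully. -/
lemma eq_elt_one_of_isIdempotentElem {e : Semi U} (he : IsIdempotentElem e) (h0 : e ≠ 0) :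
    ∃ (η : List E) (C : Set V) (h : U.Valid η C 1 η), e = elt η C 1 η h := by
  cases e with
  | zero => exact absurd rfl h0
  | elt η C k ζ h =>
    obtain ⟨v, hv⟩ := h.nonempty
    have := rel_eq_of_isIdempotentElem he (rel_base h (v := k⁻¹ • v) (by simpa using hv))
    simp only [Prod.mk.injEq] at this
    obtain ⟨rfl, -, rfl⟩ := this
    exact ⟨_, _, _, rfl⟩

lemma exists_rel_self {e : Semi U} (he : IsIdempotentElem e) (h0 : e ≠ 0) :
    ∃ x, e.Rel x x := by
  obtain ⟨η, C, h, rfl⟩ := eq_elt_one_of_isIdempotentElem he h0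
  obtain ⟨v, hv⟩ := h.nonempty
  exact ⟨(η, v, 1), by simpa using rel_base h (v := v) (by simpa using hv)⟩

/-- Nonzero idempotents below `(α, A, g, β)` come from paths strongly fixed by `g`, except when
`(α, A, g, β)` is itself idempotent. -/
lemma exists_of_mul_eq {α β η : List E} {A C : Set V} {g : G} (hs : U.Valid α A g β)
    (he : U.Valid η C 1 η) (hid : IsIdempotentElem (elt η C 1 η he))
    (h : elt α A g β hs * elt η C 1 η he = elt η C 1 η he) :
    α = β ∧ (g = 1 ∨ ∃ ε ∈ U.SF g, U.pathRng ε ⊆ A ∧ η = α ++ ε) := by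
  obtain ⟨v, hv⟩ := he.nonempty
  have h1 : (elt η C 1 η he).Rel (η, v, 1) (η, v, 1) := by
    simpa using rel_base he (v := v) (by simpa using hv)
  obtain ⟨ε, h2, h3, h4⟩ := (mul_eq_right_iff hid).1 h _ h1
  simp only [Prod.mk.injEq, mul_one] at h2 h3 h4
  obtain ⟨h4, h5, h6⟩ := h4
  have hlen : ∀ (g : G) (l : List E), (U.act g l).length = l.length := by
    intro g l
    induction l generalizing g with
    | nil => rfl
    | cons e l ih => simp [ih]
  have h7 : α ++ U.act g ε = β ++ ε := h4.symm.trans h2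
  -- The action preserves length, so both factorizations of `η` split at the same place.
  obtain ⟨rfl, h8⟩ := List.append_inj' h7 (hlen g ε)
  refine ⟨rfl, ?_⟩
  by_cases hε : ε = []
  · subst hε
    exact Or.inl h6.symm
  · refine Or.inr ⟨ε, ⟨hε, List.IsChain.right_of_append (h2 ▸ he.path_left), h8, h6.symm⟩, ?_, h2⟩
    rwa [pathRng_subset hε v, ← h8, h5, hd_act]

lemma ofPath_mul_eq {μ ν : List E} {C : Set V} (h0 : μ ≠ []) (hμ : U.IsPath μ)
    (he : U.Valid (μ ++ ν) C 1 (μ ++ ν)) (hid : IsIdempotentElem (elt (μ ++ ν) C 1 (μ ++ ν) he)) :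
    ofPath μ h0 hμ * elt (μ ++ ν) C 1 (μ ++ ν) he = elt (μ ++ ν) C 1 (μ ++ ν) he := by
  rw [mul_eq_right_iff hid]
  rintro ⟨x, v, k⟩ ⟨ζ, h1, h2, -⟩
  refine (rel_ofPath h0 hμ).2 ⟨rfl, ν ++ ζ, by simpa using h1, ?_⟩
  -- The vertex reached after `μ` lies in `C ⊆ s(μ)` if `ν` is empty, and is `r(ν)` otherwise.
  by_cases hν : ν = []
  · subst hν
    have := (he.subset h2).1
    simpa using this
  · rw [hd_append _ _ _ hν v]
    exact (pathRng_subset hν v _).1 (pathRng_subset_pathSrc_of_isPath he.path_left hν)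

/-! ### Finiteness implies Hausdorff -/

/-- If `A SF_g` has finitely many minimal elements for all `A` and all `g ≠ 1`, then the
idempotents below any element are dominated by finitely many of them. -/
lemma exists_finset_dominating
    (h : ∀ g : G, g ≠ 1 → ∀ A : Set V, U.Gen A → (minimalPaths (U.SFIn A g)).Finite)
    (s : Semi U) :
    ∃ T : Finset (Semi U), (∀ f ∈ T, IsIdempotentElem f ∧ s * f = f) ∧
      ∀ e : Semi U, IsIdempotentElem e → e ≠ 0 → s * e = e → ∃ f ∈ T, f * e = e := by
  classical
  cases s with
  | zero => exact ⟨∅, by simp, fun e _ h0 he => absurd he.symm h0⟩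
  | elt α A g β hs =>
    by_cases hαβ : α = β
    · subst hαβ
      by_cases hg : g = 1
      · subst hg
        have hid : IsIdempotentElem (elt α A 1 α hs) :=
          isIdempotentElem_of_rel fun x y => by
            obtain ⟨x1, x2, x3⟩ := x
            rintro ⟨ε, rfl, -, rfl⟩
            simp [act_one, coc_one]
        exact ⟨{elt α A 1 α hs}, by simpa using ⟨hid, hid.eq⟩, fun e _ _ he => by simpa using he⟩
      · have hpath : ∀ μ ∈ minimalPaths (U.SFIn A g), α ++ μ ≠ [] ∧ U.IsPath (α ++ μ) := by
          intro μ hμ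
          exact ⟨by simp [hμ.1.1.1], Ultragraph.IsPath.append _ hs.path_left hμ.1.1.2.1
            (hμ.1.2.trans (hs.subset.trans Set.inter_subset_left))⟩
        refine ⟨(h g hg A hs.gen).toFinset.attach.image fun μ =>
          ofPath (α ++ μ.1) (hpath _ ((Set.Finite.mem_toFinset _).1 μ.2)).1
            (hpath _ ((Set.Finite.mem_toFinset _).1 μ.2)).2,
          ?_, ?_⟩
        · intro f hf
          obtain ⟨μ, -, rfl⟩ := Finset.mem_image.1 hf
          have hμ : μ.1 ∈ minimalPaths (U.SFIn A g) :=
            (Set.Finite.mem_toFinset _).1 μ.2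
          exact ⟨isIdempotentElem_ofPath _ _, mul_ofPath_eq hs hμ.1.1 hμ.1.2 _ _⟩
        · intro e he h0 hse
          obtain ⟨η, C, hv, rfl⟩ := eq_elt_one_of_isIdempotentElem he h0
          obtain ⟨-, h1 | ⟨ε, hε, hεA, rfl⟩⟩ := exists_of_mul_eq hs hv he hse
          · exact absurd h1 hg
          · obtain ⟨μ, hμ, ν, rfl⟩ := exists_minimalPaths_prefix hε
            rw [pathRng_append hμ.1.1] at hεA
            have hμA : μ ∈ minimalPaths (U.SFIn A g) := by
              rw [minimalPaths_SFIn]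
              exact ⟨hμ, hεA⟩
            refine ⟨_, Finset.mem_image.2 ⟨⟨μ, by simpa using hμA⟩, Finset.mem_attach _ _, rfl⟩, ?_⟩
            -- Reassociating `α ++ (μ ++ ν)` also changes the types of the proofs about it, so these
            -- are generalized first.
            revert hv
            rw [← List.append_assoc]
            intro hv he _ _
            exact ofPath_mul_eq _ _ hv he
    · refine ⟨∅, by simp, fun e he h0 hse => ?_⟩
      obtain ⟨η, C, hv, rfl⟩ := eq_elt_one_of_isIdempotentElem he h0
      exact absurd (exists_of_mul_eq hs hv he hse).1 hαβ

/-- On idempotents `e` below `s* t`, the elements `s` and `t` agree. -/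
lemma mul_eq_mul_of_star_mul_mul {s t e : Semi U} (he : IsIdempotentElem e)
    (h : star s * t * e = e) : s * e = t * e := by
  refine rel_ext fun x z => ?_
  rw [rel_mul, rel_mul]
  refine exists_congr fun y => and_congr_right fun hxy => ?_
  obtain rfl := rel_eq_of_isIdempotentElem he hxy
  -- Since `s* t` fixes the point, `t` sends it to some `w` that `s*` sends back; hence `s` also
  -- sends it to `w`.
  obtain ⟨w, h1, h2⟩ := (rel_mul _ _ _ _).1 ((mul_eq_right_iff he).1 h _ hxy)
  rw [rel_star] at h2
  exact ⟨fun h3 => rel_fun h2 h3 ▸ h1, fun h3 => rel_fun h1 h3 ▸ h2⟩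

theorem t2Space_of_finite_minimalPaths
    (h : ∀ g : G, g ≠ 1 → ∀ A : Set V, U.Gen A → (minimalPaths (U.SFIn A g)).Finite) :
    T2Space (TightGroupoid (Semi U)) := by
  refine t2Space_tightGroupoid fun s t => ?_
  obtain ⟨T, hT, hcov⟩ := exists_finset_dominating h (star s * t)
  refine ⟨T, fun f hf => ⟨(hT f hf).1, mul_eq_mul_of_star_mul_mul (hT f hf).1 (hT f hf).2⟩, ?_⟩
  intro e he h0 hs _ hst
  exact hcov e he h0 (by rw [mul_assoc, ← hst, ← mul_assoc, hs])

/-! ### Hausdorff implies finiteness -/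

theorem finite_minimalPaths_of_t2Space [T2Space (TightGroupoid (Semi U))] {g : G} (hg : g ≠ 1)
    {A : Set V} (hA : U.Gen A) (hne : A.Nonempty) : (minimalPaths (U.SFIn A g)).Finite := by
  by_contra hinf
  have : Infinite (minimalPaths (U.SFIn A g)) := Set.infinite_coe_iff.2 hinf
  -- As `s(ω)` is the whole vertex set, `ω` admits every nonempty generalized vertex `A` and every
  -- `g`.
  have hs : U.Valid [] A g [] :=
    ⟨List.isChain_nil, List.isChain_nil, hA, hne, by simp [Ultragraph.pathSrc]⟩
  have ht : U.Valid [] A 1 [] :=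
    ⟨List.isChain_nil, List.isChain_nil, hA, hne, by simp [Ultragraph.pathSrc]⟩
  let ι := minimalPaths (U.SFIn A g)
  have hι : ∀ i : ι, i.1 ∈ U.SF g ∧ U.pathRng i.1 ⊆ A := fun i => i.2.1
  let f : ι → Semi U := fun i => ofPath i.1 (hι i).1.1 (hι i).1.2.1
  have hf : ∀ i, IsIdempotentElem (f i) := fun i => isIdempotentElem_ofPath _ _
  have hsf : ∀ i, elt [] A g [] hs * f i = f i := fun i =>
    mul_ofPath_eq hs (hι i).1 (hι i).2 (hι i).1.1 (hι i).1.2.1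
  -- Every path of positive length is strongly fixed by `1`, so the same lemma applies to `t`.
  have htf : ∀ i, elt [] A 1 [] ht * f i = f i := fun i =>
    mul_ofPath_eq ht ⟨(hι i).1.1, (hι i).1.2.1, U.act_one _, U.coc_one _⟩ (hι i).2
      (hι i).1.1 (hι i).1.2.1
  have hex : ∀ i, ∃ F ∈ ultrafilters (Semi U), f i ∈ F.1 := fun i =>
    exists_mem_ultrafilters (hf i) (ofPath_ne_zero _ _)
  choose F hF hfF using hex
  have hstar : ∀ (u : Semi U) (i : ι), u * f i = f i → star u * u ∈ (F i).1 := by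
    intro u i hu
    refine (F i).2.1.mem_of_mul_eq (hfF i) (isIdempotentElem_star_mul u) ?_
    rw [mul_eq_right_iff (hf i)] at hu ⊢
    exact fun x hx => (rel_mul _ _ _ _).2 ⟨x, hu x hx, rel_star.2 (hu x hx)⟩
  obtain ⟨e, he, hst⟩ := exists_mul_eq_mul_of_t2Space (Filter.hyperfilter ι) F hF
    (s := elt [] A g [] hs) (t := elt [] A 1 [] ht) (fun i => hstar _ i (hsf i))
    (fun i => hstar _ i (htf i)) (fun i => ⟨f i, hfF i, (hsf i).trans (htf i).symm⟩)
  have hti : IsIdempotentElem (elt [] A 1 [] ht) :=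
    isIdempotentElem_of_rel fun x y => by
      obtain ⟨x1, x2, x3⟩ := x
      rintro ⟨ε, rfl, -, rfl⟩
      simp [act_one, coc_one]
  have htF : ∀ i, elt [] A 1 [] ht ∈ (F i).1 := fun i =>
    (F i).2.1.mem_of_mul_eq (hfF i) hti (htf i)
  obtain ⟨i, hi⟩ := he.exists
  have hei : IsIdempotentElem e := (F i).2.1.idem e hi
  -- Cut down to the idempotent `t`, the agreement `s e = t e` becomes `s k = k`, the form that
  -- exposes a strongly fixed path.
  let k := elt [] A 1 [] ht * e
  have hk : ∀ᶠ i in (Filter.hyperfilter ι : Filter ι), k ∈ (F i).1 :=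
    he.mono fun i hi => (F i).2.1.mul_mem _ (htF i) _ hi
  have hki : IsIdempotentElem k := isIdempotentElem_mul hti hei
  have hk0 : k ≠ 0 := fun h0 => (F i).2.2 (by
    have := (F i).2.1.mul_mem _ (htF i) _ hi
    rwa [show elt [] A 1 [] ht * e = 0 from h0] at this)
  have hsk : elt [] A g [] hs * k = k := by
    change _ * (_ * e) = _ * e
    rw [idem_comm hti hei, ← mul_assoc, hst, mul_assoc, ← idem_comm hti hei, ← mul_assoc, hti.eq]
  clear_value k
  obtain ⟨η, C, hv, rfl⟩ := eq_elt_one_of_isIdempotentElem hki hk0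
  obtain ⟨-, h1 | ⟨ε, hε, -, rfl : η = ε⟩⟩ := exists_of_mul_eq hs hv hki hsk
  · exact hg h1
  obtain ⟨μ, hμ, hμε⟩ := exists_minimalPaths_prefix hε
  have huniq : ∀ i : ι, elt η C 1 η hv ∈ (F i).1 → i.1 = μ := by
    intro i hi
    have hmul := (F i).2.1.mul_mem _ hi _ (hfF i)
    have hne0 : elt η C 1 η hv * f i ≠ 0 := fun h0 => (F i).2.2 (by rwa [h0] at hmul)
    obtain ⟨x, hx⟩ := exists_rel_self ((F i).2.1.idem _ hmul) hne0
    -- A point in the domain of the nonzero product carries a word with both `i` and `η` as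
    -- prefixes, hence also `μ`. Two prefixes of one word are comparable, and both paths are
    -- minimal.
    obtain ⟨y, h1, h2⟩ := (rel_mul _ _ _ _).1 hx
    obtain ⟨rfl, ζ, h3, -⟩ := (rel_ofPath _ _).1 h1
    obtain ⟨ζ', h4, -⟩ := h2
    have hi' : i.1 ∈ minimalPaths (U.SFIn A g) := i.2
    rw [minimalPaths_SFIn] at hi'
    have hμx : μ <+: x.1 := hμε.trans ⟨ζ', h4.symm⟩
    rcases List.prefix_or_prefix_of_prefix ⟨ζ, h3.symm⟩ hμx with h5 | h5
    · exact hμ.2 _ hi'.1.1 h5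
    · exact (hi'.1.2 _ hμ.1 h5).symm
  have hfin : {i : ι | elt η C 1 η hv ∈ (F i).1}.Finite :=
    Set.Subsingleton.finite fun i hi j hj => Subtype.ext ((huniq i hi).trans (huniq j hj).symm)
  exact Filter.notMem_hyperfilter_of_finite hfin hk

end Semi

end SelfSimilarUltragraph


theorem theorem9p5 {G V E : Type*} [Group G] [MulAction G V] [MulAction G E]
    (U : SelfSimilarUltragraph G V E) :
    (∀ g : G, g ≠ 1 →
      (∀ v : V, (SelfSimilarUltragraph.minimalPaths (U.SFIn {v} g)).Finite) ∧
      (∀ e : E, (SelfSimilarUltragraph.minimalPaths (U.SFIn (U.src e) g)).Finite)) ↔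
    T2Space (InverseSemigroupWithZero.TightGroupoid (SelfSimilarUltragraph.Semi U)) := by
  constructor
  · intro h
    exact SelfSimilarUltragraph.Semi.t2Space_of_finite_minimalPaths fun g hg A hA =>
      SelfSimilarUltragraph.finite_minimalPaths_SFIn (h g hg).1 (h g hg).2 hA
  · intro h g hg
    exact ⟨fun v => SelfSimilarUltragraph.Semi.finite_minimalPaths_of_t2Space hg
        (Ultragraph.Gen.singleton v) (Set.singleton_nonempty v),
      fun e => SelfSimilarUltragraph.Semi.finite_minimalPaths_of_t2Space hg
        (Ultragraph.Gen.source e) (U.src_nonempty e)⟩
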